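/- Let $A$ be an Artin algebra, that is, an algebra that is finitely generated as a module over a commutative artinian ring $R$, and let $\Lambda = T_2(A) = \left(\begin{smallmatrix}A&A\\0&A\end{smallmatrix}\right)$ be the ring of upper triangular $2\times 2$ matrices over $A$. For $S \in \{A, \Lambda\}$, consider finitely generated left $S$-modules. For such a module $M$ let $M^* = \operatorname{Hom}_S(M,S)$, a right $S$-module, let $M^{**} = \operatorname{Hom}_S(M^*, S_S)$, a left $S$-module, and let $\phi_M : M \to M^{**}$, $\phi_M(m)(f) = f(m)$, be the canonical map. The module $M$ is *torsionless* if it embeds in a finitely generated projective left $S$-module (equivalently, if $\phi_M$ is injective), and *reflexive* if $\phi_M$ is an isomorphism. A left or right $S$-module $N$ is *semi-Gorenstein-projective* if $\operatorname{Ext}_S^i(N,S)=0$ for all $i\ge 1$; $M$ is *double semi-Gorenstein-projective* if both the left module $M$ and the right module $M^*$ are semi-Gorenstein-projective; and $M$ is *Gorenstein-projective* if it is double semi-Gorenstein-projective and reflexive. Then: 1. Every torsionless double semi-Gorenstein-projective $A$-module is Gorenstein-projective if and only if every torsionless double semi-Gorenstein-projective $T_2(A)$-module is Gorenstein-projective.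 2. Every double semi-Gorenstein-projective $A$-module $L$ with $\phi_L$ an epimorphism is Gorenstein-projective if and only if every double semi-Gorenstein-projective $T_2(A)$-module $M$ with $\phi_M$ an epimorphism is Gorenstein-projective. -/

import Mathlib

universe u v

open CategoryTheory

/-- The ring `T₂(A)` of upper triangular `2 × 2` matrices over a ring `A`, as a subring of the full
matrix ring. -/
def upperTriangularTwo (A : Type u) [Ring A] : Subring (Matrix (Fin 2) (Fin 2) A) where
  carrier := {m | m 1 0 = 0}
  mul_mem' := by
    intro a b ha hb
    simp only [Set.mem_ofPred_eq] at ha hb ⊢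
    simp [Matrix.mul_apply, Fin.sum_univ_two, ha, hb]
  one_mem' := by simp
  add_mem' := by
    intro a b ha hb
    simp only [Set.mem_ofPred_eq] at ha hb ⊢
    simp [ha, hb]
  zero_mem' := by simp
  neg_mem' := by
    intro a ha
    simp only [Set.mem_ofPred_eq] at ha ⊢
    simp [ha]

/-- The dual `M^* = Hom_A(M, A)` of a left `A`-module. It is a right `A`-module (that is, a module
over `Aᵐᵒᵖ`) through `(f a)(m) = f(m) a`. -/
abbrev LeftDual (A : Type u) [Ring A] (M : Type u) [AddCommGroup M] [Module A M] : Type u :=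
  M →ₗ[A] A

/-- The dual `N^* = Hom_A(N, A_A)` of a right `A`-module. It is a left `A`-module through
`(a f)(n) = a f(n)`. -/
abbrev RightDual (A : Type u) [Ring A] (N : Type u) [AddCommGroup N] [Module Aᵐᵒᵖ N] : Type u :=
  N →ₗ[Aᵐᵒᵖ] A

/-- The canonical map `φ_M : M → M^{**}` of left `A`-modules, `φ_M(m)(f) = f(m)`. -/
def canonicalMap (A : Type u) [Ring A] (M : Type u) [AddCommGroup M] [Module A M] :
    M →ₗ[A] RightDual A (LeftDual A M) where
  toFun m :=
    { toFun := fun f => f m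
      map_add' := fun _ _ => rfl
      map_smul' := fun _ _ => rfl }
  map_add' m m' := by
    ext f
    exact map_add f m m'
  map_smul' a m := by
    ext f
    exact map_smul f a m

/-- A left `A`-module `M` is semi-Gorenstein-projective if `Ext_A^i(M, A) = 0` for all `i ≥ 1`. -/
def IsSemiGorensteinProjective (A : Type u) [Ring A] (M : Type u) [AddCommGroup M]
    [Module A M] : Prop :=
  ∀ i : ℕ, 1 ≤ i →
    Subsingleton (Abelian.Ext.{u} (ModuleCat.of.{u} A M) (ModuleCat.of.{u} A A) i)

/-- A right `A`-module `N` is semi-Gorenstein-projective if `Ext^i(N, A_A) = 0` for all `i ≥ 1`,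
the extension groups being those of right `A`-modules. -/
def IsRightSemiGorensteinProjective (A : Type u) [Ring A] (N : Type u) [AddCommGroup N]
    [Module Aᵐᵒᵖ N] : Prop :=
  ∀ i : ℕ, 1 ≤ i →
    Subsingleton (Abelian.Ext.{u} (ModuleCat.of.{u} Aᵐᵒᵖ N) (ModuleCat.of.{u} Aᵐᵒᵖ A) i)

/-- A left `A`-module `M` is double semi-Gorenstein-projective if both the left module `M` and the
right module `M^*` are semi-Gorenstein-projective. -/
def IsDoubleSemiGorensteinProjective (A : Type u) [Ring A] (M : Type u) [AddCommGroup M]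
    [Module A M] : Prop :=
  IsSemiGorensteinProjective A M ∧ IsRightSemiGorensteinProjective A (LeftDual A M)

/-- A left `A`-module is torsionless if it is isomorphic to a submodule of a (finitely generated)
projective left `A`-module. -/
def IsTorsionless (A : Type u) [Ring A] (M : Type u) [AddCommGroup M] [Module A M] : Prop :=
  ∃ (P : Type u) (_ : AddCommGroup P) (_ : Module A P),
    Module.Finite A P ∧ Module.Projective A P ∧ ∃ f : M →ₗ[A] P, Function.Injective f

/-- A left `A`-module `M` is reflexive if `φ_M : M → M^{**}` is an isomorphism. -/
def IsReflexiveModule (A : Type u) [Ring A] (M : Type u) [AddCommGroup M] [Module A M] : Prop :=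
  Function.Bijective (canonicalMap A M)

/-- A (finitely generated) left `A`-module is Gorenstein-projective (Auslander and Bridger: of
`G`-dimension zero) if it is double semi-Gorenstein-projective and reflexive. -/
def IsGorensteinProjective (A : Type u) [Ring A] (M : Type u) [AddCommGroup M]
    [Module A M] : Prop :=
  IsDoubleSemiGorensteinProjective A M ∧ IsReflexiveModule A M

/-!
A `T₂(A)`-module `M` is an `A`-module together with an `A`-linear map `e₁₂ : e₂₂ M → e₁₁ M`. The
proof compares the two structures on `M`: `M` is double semi-Gorenstein-projective over `T₂(A)` if
and only if it is so over `A` and the dual map `(e₁₁ M)^* → (e₂₂ M)^*` is surjective.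

For the left modules, let `C` be the second column of `T₂(A)` and `A₂` the module `A` on which
`T₂(A)` acts through the lower diagonal entry. There is an exact sequence
`0 → T₂(A) → C × C → A₂ → 0`, and `C × A₂` is coinduced from `A`, so `Ext` over `T₂(A)` into it is
`Ext` over `A` into `A`; the connecting map of the sequence accounts for the surjectivity condition.
For the duals, the same criterion applies to the opposite ring, which is again triangular by
transposition along the antidiagonal. The dual of `M` over `T₂(A)` is `(Coker e₁₂)^* × (e₁₁ M)^*`,
and the exact sequence `0 → (Coker e₁₂)^* → (e₁₁ M)^* → (e₂₂ M)^* → 0` relates it to the dual over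
`A`. The same sequence identifies the biduals of `M` over `A` and over `T₂(A)`, compatibly with the
canonical maps. Conversely every `A`-module is a `T₂(A)`-module through the upper diagonal entry,
and then the surjectivity condition is vacuous since `e₂₂ M = 0`.
-/

section Ext

open Abelian Limits

universe w v' u'

variable {C : Type u'} [Category.{v'} C] [Abelian C] [HasExt.{w} C]

theorem subsingleton_prod_iff {α β : Type*} [Nonempty α] [Nonempty β] :
    Subsingleton (α × β) ↔ Subsingleton α ∧ Subsingleton β :=
  ⟨fun _ => ⟨Prod.fst_surjective (β := β).subsingleton,
    Prod.snd_surjective (α := α).subsingleton⟩, fun ⟨_, _⟩ => inferInstance⟩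

theorem subsingleton_ext_of_retract {X X' Y Y' : C} (r : Retract X X') (s : Retract Y Y') (n : ℕ)
    [Subsingleton (Ext X' Y' n)] : Subsingleton (Ext X Y n) := by
  refine subsingleton_of_forall_eq 0 fun x => ?_
  have factors : (Ext.mk₀ r.i).comp (((Ext.mk₀ r.r).comp (x.comp (Ext.mk₀ s.i) (add_zero n))
      (zero_add n)).comp (Ext.mk₀ s.r) (add_zero n)) (zero_add n) = x := by
    simp only [Ext.comp_assoc_of_third_deg_zero, Ext.mk₀_comp_mk₀_assoc, Ext.mk₀_comp_mk₀,
      Retract.retract, Ext.mk₀_id_comp, Ext.comp_mk₀_id]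
  rw [← factors, Subsingleton.elim ((Ext.mk₀ r.r).comp _ _) 0, Ext.zero_comp, Ext.comp_zero]

theorem subsingleton_ext_congr {X X' Y Y' : C} (e : X ≅ X') (e' : Y ≅ Y') (n : ℕ) :
    Subsingleton (Ext X Y n) ↔ Subsingleton (Ext X' Y' n) :=
  ⟨fun _ => subsingleton_ext_of_retract e.symm.retract e'.symm.retract n,
    fun _ => subsingleton_ext_of_retract e.retract e'.retract n⟩

theorem subsingleton_ext_biprod_left_iff {X₁ X₂ Y : C} {n : ℕ} :
    Subsingleton (Ext (X₁ ⊞ X₂) Y n) ↔ Subsingleton (Ext X₁ Y n) ∧ Subsingleton (Ext X₂ Y n) :=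
  Ext.biprodAddEquiv.toEquiv.subsingleton_congr.trans subsingleton_prod_iff

theorem subsingleton_ext_biprod_right_iff {X Y₁ Y₂ : C} {n : ℕ} :
    Subsingleton (Ext X (Y₁ ⊞ Y₂) n) ↔ Subsingleton (Ext X Y₁ n) ∧ Subsingleton (Ext X Y₂ n) :=
  Ext.addEquivBiprod.toEquiv.subsingleton_congr.trans subsingleton_prod_iff

section ShortExact

variable {S : ShortComplex C} (hS : S.ShortExact)
include hS

theorem subsingleton_ext_X₃_succ_iff {Y : C} {n : ℕ} [Subsingleton (Ext S.X₂ Y n)]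
    [Subsingleton (Ext S.X₂ Y (n + 1))] :
    Subsingleton (Ext S.X₃ Y (n + 1)) ↔ Subsingleton (Ext S.X₁ Y n) := by
  constructor <;> refine fun _ => subsingleton_of_forall_eq 0 fun x => ?_
  · obtain ⟨y, rfl⟩ := Ext.contravariant_sequence_exact₁ hS Y x (add_comm 1 n)
      (Subsingleton.elim _ _)
    rw [Subsingleton.elim y 0, Ext.comp_zero]
  · obtain ⟨y, rfl⟩ := Ext.contravariant_sequence_exact₃ hS Y x (Subsingleton.elim _ _)
      (add_comm 1 n)
    rw [Subsingleton.elim y 0, Ext.comp_zero]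

theorem subsingleton_ext_X₃_one_iff {Y : C} [Subsingleton (Ext S.X₂ Y 1)] :
    Subsingleton (Ext S.X₃ Y 1) ↔ ∀ f : S.X₁ ⟶ Y, ∃ g : S.X₂ ⟶ Y, S.f ≫ g = f := by
  refine ⟨fun _ f => ?_, fun h => subsingleton_of_forall_eq 0 fun x => ?_⟩
  · obtain ⟨y, hy⟩ := Ext.contravariant_sequence_exact₁ hS Y (Ext.mk₀ f) (add_comm 1 0)
      (Subsingleton.elim _ _)
    obtain ⟨g, rfl⟩ := (Ext.mk₀_bijective _ _).surjective y
    exact ⟨g, (Ext.mk₀_bijective _ _).injective (by rw [← hy, Ext.mk₀_comp_mk₀])⟩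
  · obtain ⟨y, rfl⟩ := Ext.contravariant_sequence_exact₃ hS Y x (Subsingleton.elim _ _)
      (add_comm 1 0)
    obtain ⟨f, rfl⟩ := (Ext.mk₀_bijective _ _).surjective y
    obtain ⟨g, rfl⟩ := h f
    rw [← Ext.mk₀_comp_mk₀, hS.extClass_comp_assoc]

theorem subsingleton_ext_X₁_succ_iff {X : C} {n : ℕ} [Subsingleton (Ext X S.X₂ n)]
    [Subsingleton (Ext X S.X₂ (n + 1))] :
    Subsingleton (Ext X S.X₁ (n + 1)) ↔ Subsingleton (Ext X S.X₃ n) := by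
  constructor <;> refine fun _ => subsingleton_of_forall_eq 0 fun x => ?_
  · obtain ⟨y, rfl⟩ := Ext.covariant_sequence_exact₃ X hS x rfl (Subsingleton.elim _ _)
    rw [Subsingleton.elim y 0, Ext.zero_comp]
  · obtain ⟨y, rfl⟩ := Ext.covariant_sequence_exact₁ X hS x (Subsingleton.elim _ _) rfl
    rw [Subsingleton.elim y 0, Ext.zero_comp]

theorem subsingleton_ext_X₁_one_iff {X : C} [Subsingleton (Ext X S.X₂ 1)] :
    Subsingleton (Ext X S.X₁ 1) ↔ ∀ f : X ⟶ S.X₃, ∃ g : X ⟶ S.X₂, g ≫ S.g = f := by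
  refine ⟨fun _ f => ?_, fun h => subsingleton_of_forall_eq 0 fun x => ?_⟩
  · obtain ⟨y, hy⟩ := Ext.covariant_sequence_exact₃ X hS (Ext.mk₀ f) rfl (Subsingleton.elim _ _)
    obtain ⟨g, rfl⟩ := (Ext.mk₀_bijective _ _).surjective y
    exact ⟨g, (Ext.mk₀_bijective _ _).injective (by rw [← hy, Ext.mk₀_comp_mk₀])⟩
  · obtain ⟨y, rfl⟩ := Ext.covariant_sequence_exact₁ X hS x (Subsingleton.elim _ _) rfl
    obtain ⟨f, rfl⟩ := (Ext.mk₀_bijective _ _).surjective y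
    obtain ⟨g, rfl⟩ := h f
    rw [← Ext.mk₀_comp_mk₀, Ext.comp_assoc_of_second_deg_zero, hS.comp_extClass, Ext.comp_zero]

end ShortExact

end Ext

section PositiveExt

open Abelian

/-- `Ext_S^i(X, D) = 0` for all `i ≥ 1`; semi-Gorenstein-projectivity is the case `D = S`. -/
def PositiveExtVanishes (S X D : Type u) [Ring S] [AddCommGroup X] [Module S X] [AddCommGroup D]
    [Module S D] : Prop :=
  ∀ n : ℕ, Subsingleton (Ext.{u} (ModuleCat.of.{u} S X) (ModuleCat.of.{u} S D) (n + 1))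

variable {S X X' Y Z D D' D'' : Type u} [Ring S] [AddCommGroup X] [Module S X]
  [AddCommGroup X'] [Module S X'] [AddCommGroup Y] [Module S Y] [AddCommGroup Z] [Module S Z]
  [AddCommGroup D] [Module S D] [AddCommGroup D'] [Module S D'] [AddCommGroup D''] [Module S D'']

theorem positiveExtVanishes_self_iff :
    PositiveExtVanishes S X S ↔ IsSemiGorensteinProjective S X :=
  ⟨fun h i hi => Nat.sub_add_cancel hi ▸ h (i - 1), fun h n => h (n + 1) n.succ_pos⟩

theorem positiveExtVanishes_congr (e : X ≃ₗ[S] X') (e' : D ≃ₗ[S] D') :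
    PositiveExtVanishes S X D ↔ PositiveExtVanishes S X' D' :=
  forall_congr' fun _ => subsingleton_ext_congr e.toModuleIso e'.toModuleIso _

theorem positiveExtVanishes_prod_left_iff :
    PositiveExtVanishes S (X × Y) D ↔ PositiveExtVanishes S X D ∧ PositiveExtVanishes S Y D := by
  simp only [PositiveExtVanishes, ← forall_and, ← subsingleton_ext_biprod_left_iff]
  exact forall_congr' fun _ => subsingleton_ext_congr
    (ModuleCat.biprodIsoProd (.of S X) (.of S Y)).symm (Iso.refl _) _

theorem positiveExtVanishes_prod_right_iff :
    PositiveExtVanishes S X (D × D') ↔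
      PositiveExtVanishes S X D ∧ PositiveExtVanishes S X D' := by
  simp only [PositiveExtVanishes, ← forall_and, ← subsingleton_ext_biprod_right_iff]
  exact forall_congr' fun _ => subsingleton_ext_congr (Iso.refl _)
    (ModuleCat.biprodIsoProd (.of S D) (.of S D')).symm _

theorem PositiveExtVanishes.of_leftInverse {i : D →ₗ[S] D'} {r : D' →ₗ[S] D}
    (hri : Function.LeftInverse r i) (h : PositiveExtVanishes S X D') :
    PositiveExtVanishes S X D := fun n => by
  have := h n
  exact subsingleton_ext_of_retract (.refl _)
    ⟨ModuleCat.ofHom i, ModuleCat.ofHom r, by ext x; exact hri x⟩ _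

theorem PositiveExtVanishes.of_projective (S X D : Type u) [Ring S] [AddCommGroup X] [Module S X]
    [AddCommGroup D] [Module S D] [Module.Projective S X] : PositiveExtVanishes S X D := fun _ =>
  have : Projective (ModuleCat.of.{u} S X) :=
    (IsProjective.iff_projective (ModuleCat.of.{u} S X)).1 ‹Module.Projective S X›
  Ext.subsingleton_of_projective _ _ _

theorem shortExact_of_exact (f : X →ₗ[S] Y) (g : Y →ₗ[S] Z) (hf : Function.Injective f)
    (hfg : Function.Exact f g) (hg : Function.Surjective g) :
    (ModuleCat.shortComplexOfCompEqZero f g hfg.linearMap_comp_eq_zero).ShortExact :=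
  ModuleCat.shortComplex_shortExact _ hfg hf hg

theorem forall_exists_ofHom_comp_eq_iff {f : X →ₗ[S] Y} :
    (∀ u : ModuleCat.of S X ⟶ ModuleCat.of S D, ∃ w : ModuleCat.of S Y ⟶ ModuleCat.of S D,
      ModuleCat.ofHom f ≫ w = u) ↔ ∀ u : X →ₗ[S] D, ∃ w : Y →ₗ[S] D, w ∘ₗ f = u := by
  refine ModuleCat.homEquiv.forall_congr fun u => ModuleCat.homEquiv.exists_congr fun w => ?_
  exact ⟨fun h => congrArg ModuleCat.Hom.hom h, fun h => ModuleCat.hom_ext h⟩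

theorem forall_exists_comp_ofHom_eq_iff {g : D' →ₗ[S] D''} :
    (∀ u : ModuleCat.of S X ⟶ ModuleCat.of S D'', ∃ w : ModuleCat.of S X ⟶ ModuleCat.of S D',
      w ≫ ModuleCat.ofHom g = u) ↔ ∀ u : X →ₗ[S] D'', ∃ w : X →ₗ[S] D', g ∘ₗ w = u := by
  refine ModuleCat.homEquiv.forall_congr fun u => ModuleCat.homEquiv.exists_congr fun w => ?_
  exact ⟨fun h => congrArg ModuleCat.Hom.hom h, fun h => ModuleCat.hom_ext h⟩

theorem positiveExtVanishes_left_iff_of_exact {f : X →ₗ[S] Y} {g : Y →ₗ[S] Z}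
    (hf : Function.Injective f) (hfg : Function.Exact f g) (hg : Function.Surjective g)
    (hY : PositiveExtVanishes S Y D) :
    PositiveExtVanishes S Z D ↔
      (∀ u : X →ₗ[S] D, ∃ w : Y →ₗ[S] D, w ∘ₗ f = u) ∧ PositiveExtVanishes S X D := by
  have (n : ℕ) := hY n
  have hS := shortExact_of_exact f g hf hfg hg
  rw [PositiveExtVanishes, ← Nat.and_forall_add_one, ← forall_exists_ofHom_comp_eq_iff]
  exact and_congr (subsingleton_ext_X₃_one_iff hS)
    (forall_congr' fun _ => subsingleton_ext_X₃_succ_iff hS)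

theorem positiveExtVanishes_right_iff_of_exact {f : D →ₗ[S] D'} {g : D' →ₗ[S] D''}
    (hf : Function.Injective f) (hfg : Function.Exact f g) (hg : Function.Surjective g)
    (hD' : PositiveExtVanishes S X D') :
    PositiveExtVanishes S X D ↔
      (∀ u : X →ₗ[S] D'', ∃ w : X →ₗ[S] D', g ∘ₗ w = u) ∧ PositiveExtVanishes S X D'' := by
  have (n : ℕ) := hD' n
  have hS := shortExact_of_exact f g hf hfg hg
  rw [PositiveExtVanishes, ← Nat.and_forall_add_one, ← forall_exists_comp_ofHom_eq_iff]
  exact and_congr (subsingleton_ext_X₁_one_iff hS)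
    (forall_congr' fun _ => subsingleton_ext_X₁_succ_iff hS)

end PositiveExt

section Coinduced

variable {B Γ D C : Type u} [Ring B] [Ring Γ] [Module B Γ]
  [AddCommGroup D] [Module Γ D] [Module B D] [IsScalarTower B Γ D] [AddCommGroup C] [Module B C]

/-- A `B`-linear map `π : D → C` exhibits the `Γ`-module `D` as coinduced from the `B`-module `C`:
composition with `π` identifies the `Γ`-linear maps `M → D` with the `B`-linear maps `M → C`. -/
def IsCoinducedBy (π : D →ₗ[B] C) : Prop :=
  ∀ (M : Type u) [AddCommGroup M] [Module Γ M] [Module B M] [IsScalarTower B Γ M],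
    Function.Bijective fun φ : M →ₗ[Γ] D => π ∘ₗ φ.restrictScalars B

theorem IsCoinducedBy.forall_exists_comp_eq_iff {π : D →ₗ[B] C} (hπ : IsCoinducedBy (Γ := Γ) π)
    {M N : Type u} [AddCommGroup M] [Module Γ M] [Module B M] [IsScalarTower B Γ M]
    [AddCommGroup N] [Module Γ N] [Module B N] [IsScalarTower B Γ N] (f : M →ₗ[Γ] N) :
    (∀ u : M →ₗ[Γ] D, ∃ w : N →ₗ[Γ] D, w ∘ₗ f = u) ↔
      ∀ u : M →ₗ[B] C, ∃ w : N →ₗ[B] C, w ∘ₗ f.restrictScalars B = u :=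
  (Equiv.ofBijective _ (hπ M)).forall_congr fun u =>
    (Equiv.ofBijective _ (hπ N)).exists_congr fun w =>
      ((hπ M).injective.eq_iff (a := w ∘ₗ f) (b := u)).symm

theorem IsCoinducedBy.positiveExtVanishes_iff [IsScalarTower B Γ Γ] [Module.Projective B Γ]
    {π : D →ₗ[B] C} (hπ : IsCoinducedBy (Γ := Γ) π) (M : Type u) [AddCommGroup M] [Module Γ M]
    [Module B M] [IsScalarTower B Γ M] :
    PositiveExtVanishes Γ M D ↔ PositiveExtVanishes B M C := by
  -- Dimension shifting along a free cover over `Γ`, which is also projective over `B`.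
  refine forall_congr' fun n => ?_
  induction n using Nat.strong_induction_on generalizing M with | _ n ih
  let g := Finsupp.linearCombination Γ (id : M → M)
  have hg : Function.Surjective g := Finsupp.linearCombination_id_surjective Γ M
  let ι := (LinearMap.ker g).subtype
  have hι : Function.Injective ι := (LinearMap.ker g).injective_subtype
  have hιg : Function.Exact ι g := g.exact_subtype_ker_map
  have hΓ := shortExact_of_exact (X := LinearMap.ker g) ι g hι hιg hg
  have hB := shortExact_of_exact (X := LinearMap.ker g) (ι.restrictScalars B)
    (g.restrictScalars B) hι hιg hg
  have : Module.Projective B (M →₀ Γ) := by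
    classical exact .of_equiv (finsuppLequivDFinsupp B).symm
  have (i : ℕ) := PositiveExtVanishes.of_projective Γ (M →₀ Γ) D i
  have (i : ℕ) := PositiveExtVanishes.of_projective B (M →₀ Γ) C i
  cases n with
  | zero => calc
      _ ↔ ∀ u : LinearMap.ker g →ₗ[Γ] D, ∃ w : (M →₀ Γ) →ₗ[Γ] D, w ∘ₗ ι = u :=
        (subsingleton_ext_X₃_one_iff hΓ).trans forall_exists_ofHom_comp_eq_iff
      _ ↔ ∀ u : LinearMap.ker g →ₗ[B] C, ∃ w : (M →₀ Γ) →ₗ[B] C,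
          w ∘ₗ ι.restrictScalars B = u :=
        hπ.forall_exists_comp_eq_iff (M := LinearMap.ker g) ι
      _ ↔ _ := ((subsingleton_ext_X₃_one_iff hB).trans forall_exists_ofHom_comp_eq_iff).symm
  | succ n =>
    rw [subsingleton_ext_X₃_succ_iff hΓ, subsingleton_ext_X₃_succ_iff hB]
    exact ih n n.lt_succ_self (LinearMap.ker g)

end Coinduced

/-- Coordinates identifying a ring `Γ` with the ring of upper triangular `2 × 2` matrices over
`B`: the element with coordinates `(a, b, c)` corresponds to the matrix with first row `(a, b)` and
second row `(0, c)`. They allow `T₂(A)` and its opposite ring to be treated at once. -/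
structure TriangularCoordinates (B Γ : Type u) [Ring B] [Ring Γ] [Module B Γ] where
  /-- The entries of an element of `Γ`. -/
  coord : Γ ≃ₗ[B] B × B × B
  coord_one : coord 1 = (1, 0, 1)
  coord_mul : ∀ x y, coord (x * y) = ((coord x).1 * (coord y).1,
    (coord x).1 * (coord y).2.1 + (coord x).2.1 * (coord y).2.2, (coord x).2.2 * (coord y).2.2)

namespace TriangularCoordinates

section MatrixUnits

variable {B Γ : Type u} [Ring B] [Ring Γ] [Module B Γ] (c : TriangularCoordinates B Γ)

/-- The first diagonal matrix unit. -/
def e₁₁ : Γ := c.coord.symm (1, 0, 0)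

/-- The off-diagonal matrix unit. -/
def e₁₂ : Γ := c.coord.symm (0, 1, 0)

/-- The second diagonal matrix unit. -/
def e₂₂ : Γ := c.coord.symm (0, 0, 1)

@[simp] theorem coord_e₁₁ : c.coord c.e₁₁ = (1, 0, 0) := by simp [e₁₁]

@[simp] theorem coord_e₁₂ : c.coord c.e₁₂ = (0, 1, 0) := by simp [e₁₂]

@[simp] theorem coord_e₂₂ : c.coord c.e₂₂ = (0, 0, 1) := by simp [e₂₂]

theorem projective (c : TriangularCoordinates B Γ) : Module.Projective B Γ :=
  Module.Projective.of_equiv c.coord.symm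

/-- The first diagonal entry, as a ring homomorphism. -/
def fstHom : Γ →+* B where
  toFun x := (c.coord x).1
  map_one' := by simp [coord_one]
  map_mul' x y := by simp [coord_mul]
  map_zero' := by simp
  map_add' x y := by simp

/-- The second diagonal entry, as a ring homomorphism. -/
def sndHom : Γ →+* B where
  toFun x := (c.coord x).2.2
  map_one' := by simp [coord_one]
  map_mul' x y := by simp [coord_mul]
  map_zero' := by simp
  map_add' x y := by simp

variable {M : Type u} [AddCommGroup M] [Module Γ M]

theorem e₁₁_smul_add_e₂₂_smul (m : M) : c.e₁₁ • m + c.e₂₂ • m = m := by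
  rw [← add_smul, show c.e₁₁ + c.e₂₂ = 1 from c.coord.injective (by simp [coord_one]), one_smul]

variable [Module B M] [IsScalarTower B Γ M]

theorem e₁₁_smul_smul (x : Γ) (m : M) :
    c.e₁₁ • x • m = (c.coord x).1 • c.e₁₁ • m + (c.coord x).2.1 • c.e₁₂ • m := by
  rw [smul_smul, ← smul_assoc, ← smul_assoc, ← add_smul]
  exact congrArg (· • m) (c.coord.injective (by simp [coord_mul]))

theorem e₁₂_smul_smul (x : Γ) (m : M) : c.e₁₂ • x • m = (c.coord x).2.2 • c.e₁₂ • m := by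
  rw [smul_smul, ← smul_assoc]
  exact congrArg (· • m) (c.coord.injective (by simp [coord_mul]))

theorem e₂₂_smul_smul (x : Γ) (m : M) : c.e₂₂ • x • m = (c.coord x).2.2 • c.e₂₂ • m := by
  rw [smul_smul, ← smul_assoc]
  exact congrArg (· • m) (c.coord.injective (by simp [coord_mul]))

/-- The action of `e₁₁` as a `B`-linear map. -/
def smulE₁₁ : M →ₗ[B] M where
  toFun m := c.e₁₁ • m
  map_add' := smul_add _
  map_smul' b m := by rw [← smul_one_smul Γ b m, e₁₁_smul_smul]; simp [coord_one]

/-- The action of `e₁₂` as a `B`-linear map. -/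
def smulE₁₂ : M →ₗ[B] M where
  toFun m := c.e₁₂ • m
  map_add' := smul_add _
  map_smul' b m := by rw [← smul_one_smul Γ b m, e₁₂_smul_smul]; simp [coord_one]

/-- The action of `e₂₂` as a `B`-linear map. -/
def smulE₂₂ : M →ₗ[B] M where
  toFun m := c.e₂₂ • m
  map_add' := smul_add _
  map_smul' b m := by rw [← smul_one_smul Γ b m, e₂₂_smul_smul]; simp [coord_one]

end MatrixUnits

section DualSurjective

variable {B Γ : Type u} [Ring B] [Ring Γ] [Module B Γ] (c : TriangularCoordinates B Γ)

/-- If a `Γ`-module `M` is regarded as a `B`-linear map `e₁₂ : e₂₂ M → e₁₁ M`, this says that the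
dual map `(e₁₁ M)^* → (e₂₂ M)^*` is surjective. -/
def DualSurjective (M : Type u) [AddCommGroup M] [Module B M] [Module Γ M] : Prop :=
  ∀ h : M →ₗ[B] B, ∃ v : M →ₗ[B] B, ∀ m, v (c.e₁₂ • m) = h (c.e₂₂ • m)

/-- The left ideal of the matrices in `Γ` whose first column is zero. -/
def column : Submodule Γ Γ where
  carrier := {x | (c.coord x).1 = 0}
  add_mem' hx hy := by simp_all
  zero_mem' := by simp
  smul_mem' x y hy := by simp_all [coord_mul]

@[simp] theorem coord_column_fst (x : c.column) : (c.coord x).1 = 0 := x.2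

variable {c} in
theorem column_ext {x y : c.column} (h : (c.coord x).2 = (c.coord y).2) : x = y :=
  Subtype.ext (c.coord.injective (Prod.ext (by simp) h))

/-- Right multiplication by `e₁₂`, which moves the first column to the second. -/
def fstColumn : Γ →ₗ[Γ] c.column :=
  (LinearMap.toSpanSingleton Γ Γ c.e₁₂).codRestrict c.column fun x =>
    show (c.coord (x * c.e₁₂)).1 = 0 by simp [coord_mul]

/-- Right multiplication by `e₂₂`, which keeps the second column. -/
def sndColumn : Γ →ₗ[Γ] c.column :=
  (LinearMap.toSpanSingleton Γ Γ c.e₂₂).codRestrict c.column fun x =>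
    show (c.coord (x * c.e₂₂)).1 = 0 by simp [coord_mul]

theorem coord_fstColumn (x : Γ) : c.coord (c.fstColumn x) = (0, (c.coord x).1, 0) := by
  rw [show (c.fstColumn x : Γ) = x * c.e₁₂ from rfl]
  simp [coord_mul]

theorem coord_sndColumn (x : Γ) :
    c.coord (c.sndColumn x) = (0, (c.coord x).2.1, (c.coord x).2.2) := by
  rw [show (c.sndColumn x : Γ) = x * c.e₂₂ from rfl]
  simp [coord_mul]

theorem sndColumn_coe (x : c.column) : c.sndColumn x = x :=
  column_ext (by simp [coord_sndColumn])

/-- The module `B` on which `Γ` acts through its second diagonal entry. -/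
def LowerEntry (_ : TriangularCoordinates B Γ) : Type u := B

instance : AddCommGroup c.LowerEntry := inferInstanceAs (AddCommGroup B)

instance : Module B c.LowerEntry := inferInstanceAs (Module B B)

instance : Module Γ c.LowerEntry := Module.compHom B c.sndHom

/-- The underlying element of `B`. -/
def lowerEntryEquiv : c.LowerEntry ≃ₗ[B] B := LinearEquiv.refl B B

theorem lowerEntryEquiv_smul (x : Γ) (b : c.LowerEntry) :
    c.lowerEntryEquiv (x • b) = (c.coord x).2.2 * c.lowerEntryEquiv b := rfl

instance : IsScalarTower B Γ c.LowerEntry :=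
  ⟨fun b x y => c.lowerEntryEquiv.injective (by simp [lowerEntryEquiv_smul, mul_assoc])⟩

/-- The lower entry of a column. -/
def lowerEntry : c.column →ₗ[Γ] c.LowerEntry where
  toFun x := c.lowerEntryEquiv.symm (c.coord x).2.2
  map_add' x y := by simp
  map_smul' x y := c.lowerEntryEquiv.injective (by simp [lowerEntryEquiv_smul, coord_mul])

variable {c} in
theorem lowerEntryEquiv_lowerEntry (x : c.column) :
    c.lowerEntryEquiv (c.lowerEntry x) = (c.coord x).2.2 := rfl

theorem lowerEntry_surjective : Function.Surjective c.lowerEntry := fun b =>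
  ⟨c.sndColumn (c.coord.symm (0, 0, c.lowerEntryEquiv b)),
    c.lowerEntryEquiv.injective (by simp [lowerEntryEquiv_lowerEntry, coord_sndColumn])⟩

theorem columns_injective : Function.Injective (c.fstColumn.prod c.sndColumn) := by
  refine (injective_iff_map_eq_zero _).2 fun x hx => c.coord.injective ?_
  obtain ⟨h₁, h₂⟩ : c.fstColumn x = 0 ∧ c.sndColumn x = 0 := Prod.ext_iff.1 hx
  have fst_eq := c.coord_fstColumn x
  have snd_eq := c.coord_sndColumn x
  rw [h₁] at fst_eq
  rw [h₂] at snd_eq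
  simp only [ZeroMemClass.coe_zero, map_zero, Prod.ext_iff, Prod.fst_zero, Prod.snd_zero]
    at fst_eq snd_eq ⊢
  exact ⟨fst_eq.2.1.symm, snd_eq.2.1.symm, snd_eq.2.2.symm⟩

theorem exact_columns_lowerEntry :
    Function.Exact (c.fstColumn.prod c.sndColumn)
      (c.lowerEntry ∘ₗ LinearMap.fst Γ c.column c.column) := by
  refine fun y => ⟨fun hy => ?_, ?_⟩
  · have hy : (c.coord y.1).2.2 = 0 := hy
    exact ⟨c.coord.symm ((c.coord y.1).2.1, (c.coord y.2).2),
      Prod.ext (column_ext (by simp [coord_fstColumn, Prod.ext_iff, hy]))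
        (column_ext (by simp [coord_sndColumn]))⟩
  · rintro ⟨x, rfl⟩
    exact congrArg (·.2.2) (c.coord_fstColumn x)

section Hom

variable {M : Type u} [AddCommGroup M] [Module B M] [Module Γ M] [IsScalarTower B Γ M]

/-- The `Γ`-linear map to the columns with upper entry `m ↦ v (e₁₁ m)`. -/
def homColumn (v : M →ₗ[B] B) : M →ₗ[Γ] c.column where
  toFun m := ⟨c.coord.symm (0, v (c.e₁₁ • m), v (c.e₁₂ • m)), by simp [column]⟩
  map_add' m m' := Subtype.ext (c.coord.injective (by simp))
  map_smul' x m := Subtype.ext (c.coord.injective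
    (by simp [coord_mul, e₁₁_smul_smul, e₁₂_smul_smul]))

/-- The `Γ`-linear map `m ↦ h (e₂₂ m)`. -/
def homLowerEntry (h : M →ₗ[B] B) : M →ₗ[Γ] c.LowerEntry where
  toFun m := c.lowerEntryEquiv.symm (h (c.e₂₂ • m))
  map_add' m m' := by simp
  map_smul' x m := c.lowerEntryEquiv.injective (by simp [lowerEntryEquiv_smul, e₂₂_smul_smul])

theorem coord_homColumn (v : M →ₗ[B] B) (m : M) :
    c.coord (c.homColumn v m) = (0, v (c.e₁₁ • m), v (c.e₁₂ • m)) := by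
  simp [homColumn]

variable [IsScalarTower B Γ Γ]

/-- The upper entry of a column. -/
def upperEntry : c.column →ₗ[B] B where
  toFun x := (c.coord x).2.1
  map_add' x y := by simp
  map_smul' b x := by simp

theorem dualSurjective_iff_lifting :
    c.DualSurjective M ↔ ∀ u : M →ₗ[Γ] c.LowerEntry, ∃ w : M →ₗ[Γ] c.column × c.column,
      (c.lowerEntry ∘ₗ LinearMap.fst Γ c.column c.column) ∘ₗ w = u := by
  refine ⟨fun H u => ?_, fun H h => ?_⟩
  · obtain ⟨v, hv⟩ := H (c.lowerEntryEquiv.toLinearMap ∘ₗ u.restrictScalars B)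
    refine ⟨(c.homColumn v).prod 0, LinearMap.ext fun m => ?_⟩
    have hm : u (c.e₂₂ • m) = u m := c.lowerEntryEquiv.injective
      (by simp [lowerEntryEquiv_smul])
    exact (congrArg (·.2.2) (c.coord_homColumn v m)).trans ((hv m).trans hm)
  · obtain ⟨w, hw⟩ := H (c.homLowerEntry h)
    let w₁ := LinearMap.fst Γ c.column c.column ∘ₗ w
    refine ⟨c.upperEntry ∘ₗ w₁.restrictScalars B, fun m => ?_⟩
    have hm : (c.coord (w₁ (c.e₁₂ • m))).2.1 = (c.coord (w₁ m)).2.2 := by simp [coord_mul]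
    exact hm.trans (LinearMap.congr_fun hw m)

end Hom

section Ext

variable [IsScalarTower B Γ Γ]

/-- The sum of the upper entry of a column and a lower entry. -/
def entrySum : c.column × c.LowerEntry →ₗ[B] B :=
  c.upperEntry.coprod c.lowerEntryEquiv.toLinearMap

theorem entrySum_apply (y : c.column × c.LowerEntry) :
    c.entrySum y = (c.coord y.1).2.1 + c.lowerEntryEquiv y.2 := rfl

theorem isCoinducedBy_entrySum : IsCoinducedBy (Γ := Γ) c.entrySum := by
  intro M _ _ _ _
  refine ⟨fun φ ψ h => LinearMap.ext fun m => ?_, fun w => ?_⟩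
  · have recover (y : c.column × c.LowerEntry) :
        (c.coord y.1).2 = (c.entrySum (c.e₁₁ • y), c.entrySum (c.e₁₂ • y)) ∧
          c.lowerEntryEquiv y.2 = c.entrySum (c.e₂₂ • y) := by
      simp [entrySum_apply, lowerEntryEquiv_smul, coord_mul]
    have hm (x : Γ) : c.entrySum (x • φ m) = c.entrySum (x • ψ m) := by
      simpa using LinearMap.congr_fun h (x • m)
    refine Prod.ext (column_ext ?_) (c.lowerEntryEquiv.injective ?_)
    · rw [(recover (φ m)).1, (recover (ψ m)).1, hm, hm]
    · rw [(recover (φ m)).2, (recover (ψ m)).2, hm]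
  · refine ⟨(c.homColumn w).prod (c.homLowerEntry w), LinearMap.ext fun m => ?_⟩
    calc
      (c.coord (c.homColumn w m)).2.1 + w (c.e₂₂ • m) = w (c.e₁₁ • m + c.e₂₂ • m) := by
        rw [coord_homColumn, map_add]
      _ = w m := by rw [e₁₁_smul_add_e₂₂_smul]

theorem isSemiGorensteinProjective_iff {M : Type u} [AddCommGroup M] [Module B M] [Module Γ M]
    [IsScalarTower B Γ M] :
    IsSemiGorensteinProjective Γ M ↔ IsSemiGorensteinProjective B M ∧ c.DualSurjective M := by
  have := c.projective
  have hcol (h : PositiveExtVanishes Γ M c.column) :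
      PositiveExtVanishes Γ M Γ ↔ c.DualSurjective M ∧ PositiveExtVanishes Γ M c.LowerEntry :=
    (positiveExtVanishes_right_iff_of_exact c.columns_injective c.exact_columns_lowerEntry
      (c.lowerEntry_surjective.comp Prod.fst_surjective)
      (positiveExtVanishes_prod_right_iff.2 ⟨h, h⟩)).trans
        (and_congr_left fun _ => c.dualSurjective_iff_lifting.symm)
  have hB : PositiveExtVanishes B M B ↔
      PositiveExtVanishes Γ M c.column ∧ PositiveExtVanishes Γ M c.LowerEntry :=
    (c.isCoinducedBy_entrySum.positiveExtVanishes_iff M).symm.trans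
      positiveExtVanishes_prod_right_iff
  have hΓ : PositiveExtVanishes Γ M Γ → PositiveExtVanishes Γ M c.column :=
    .of_leftInverse (i := c.column.subtype) c.sndColumn_coe
  rw [← positiveExtVanishes_self_iff, ← positiveExtVanishes_self_iff, hB]
  tauto

end Ext

end DualSurjective

end TriangularCoordinates

section UpperTriangular

open MulOpposite

variable (A : Type u) [Ring A]

/-- The embedding of `A` into `T₂(A)` as the scalar matrices, through which `T₂(A)` is regarded as
an `A`-bimodule. -/
def upperTriangularScalar : A →+* upperTriangularTwo A :=
  (Matrix.scalar (Fin 2)).codRestrict (upperTriangularTwo A) fun a =>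
    show Matrix.scalar (Fin 2) a 1 0 = 0 by simp

instance : Module A (upperTriangularTwo A) := Module.compHom _ (upperTriangularScalar A)

instance : Module Aᵐᵒᵖ (upperTriangularTwo A) := Module.compHom _ (upperTriangularScalar A).op

variable {A}

@[simp] theorem upperTriangular_smul_apply (a : A) (x : upperTriangularTwo A) (i j : Fin 2) :
    (a • x).1 i j = a * x.1 i j :=
  (congrFun₂ (Matrix.smul_eq_diagonal_mul x.1 a) i j).symm

@[simp] theorem upperTriangular_op_smul_apply (a : A) (x : upperTriangularTwo A) (i j : Fin 2) :
    (op a • x).1 i j = x.1 i j * a :=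
  Matrix.mul_diagonal _ _ _ _

instance : IsScalarTower A (upperTriangularTwo A) (upperTriangularTwo A) :=
  ⟨fun a => mul_assoc (upperTriangularScalar A a)⟩

instance : SMulCommClass (upperTriangularTwo A) Aᵐᵒᵖ (upperTriangularTwo A) :=
  ⟨fun x a y => (mul_assoc x y (upperTriangularScalar A a.unop)).symm⟩

instance : IsScalarTower Aᵐᵒᵖ (upperTriangularTwo A)ᵐᵒᵖ (upperTriangularTwo A) :=
  ⟨fun a x y => (mul_assoc y x.unop (upperTriangularScalar A a.unop)).symm⟩

instance : IsScalarTower Aᵐᵒᵖ (upperTriangularTwo A)ᵐᵒᵖ (upperTriangularTwo A)ᵐᵒᵖ :=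
  ⟨fun a x y => congrArg op (smul_assoc a x y.unop)⟩

@[simp] theorem upperTriangular_one_zero (x : upperTriangularTwo A) : x.1 1 0 = 0 := x.2

theorem upperTriangular_ext {x y : upperTriangularTwo A} (h₁₁ : x.1 0 0 = y.1 0 0)
    (h₁₂ : x.1 0 1 = y.1 0 1) (h₂₂ : x.1 1 1 = y.1 1 1) : x = y := by
  ext i j
  fin_cases i <;> fin_cases j <;> simp [h₁₁, h₁₂, h₂₂]

variable (A)

/-- The entries of an upper triangular matrix, as an `A`-linear equivalence. -/
def upperTriangularEntries : upperTriangularTwo A ≃ₗ[A] A × A × A where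
  toFun x := (x.1 0 0, x.1 0 1, x.1 1 1)
  invFun t := ⟨!![t.1, t.2.1; 0, t.2.2], show !![t.1, t.2.1; 0, t.2.2] 1 0 = 0 by simp⟩
  map_add' x y := rfl
  map_smul' a x := by simp
  left_inv x := upperTriangular_ext rfl rfl rfl
  right_inv t := rfl

variable {A} in
theorem upperTriangularEntries_apply (x : upperTriangularTwo A) :
    upperTriangularEntries A x = (x.1 0 0, x.1 0 1, x.1 1 1) := rfl

/-- The entries of an upper triangular matrix, reflected along the antidiagonal. -/
def upperTriangularOpEntries : (upperTriangularTwo A)ᵐᵒᵖ ≃ₗ[Aᵐᵒᵖ] Aᵐᵒᵖ × Aᵐᵒᵖ × Aᵐᵒᵖ where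
  toFun x := (op (x.unop.1 1 1), op (x.unop.1 0 1), op (x.unop.1 0 0))
  invFun t := op ((upperTriangularEntries A).symm (t.2.2.unop, t.2.1.unop, t.1.unop))
  map_add' x y := rfl
  map_smul' a x := by induction a; simp
  left_inv x := unop_injective (upperTriangular_ext rfl rfl rfl)
  right_inv t := rfl

variable {A} in
theorem upperTriangularOpEntries_apply (x : (upperTriangularTwo A)ᵐᵒᵖ) :
    upperTriangularOpEntries A x = (op (x.unop.1 1 1), op (x.unop.1 0 1), op (x.unop.1 0 0)) := rfl

/-- The tautological coordinates on `T₂(A)`. -/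
def upperTriangularCoordinates : TriangularCoordinates A (upperTriangularTwo A) where
  coord := upperTriangularEntries A
  coord_one := by simp [upperTriangularEntries_apply]
  coord_mul x y := by simp [upperTriangularEntries_apply, Matrix.mul_apply]

/-- Transposition along the antidiagonal identifies the opposite of `T₂(A)` with `T₂(Aᵐᵒᵖ)`. -/
def upperTriangularOpCoordinates : TriangularCoordinates Aᵐᵒᵖ (upperTriangularTwo A)ᵐᵒᵖ where
  coord := upperTriangularOpEntries A
  coord_one := by simp [upperTriangularOpEntries_apply]
  coord_mul x y := by simp [upperTriangularOpEntries_apply, Matrix.mul_apply, add_comm]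

end UpperTriangular

section Dual

open MulOpposite

theorem positiveExtVanishes_op_iff {A N : Type u} [Ring A] [AddCommGroup N] [Module Aᵐᵒᵖ N] :
    PositiveExtVanishes Aᵐᵒᵖ N Aᵐᵒᵖ ↔ IsRightSemiGorensteinProjective A N :=
  (positiveExtVanishes_congr (.refl _ _) (opLinearEquiv Aᵐᵒᵖ (M := A)).symm).trans
    ⟨fun h i hi => Nat.sub_add_cancel hi ▸ h (i - 1), fun h n => h (n + 1) n.succ_pos⟩

variable {A : Type u} [Ring A] {M : Type u} [AddCommGroup M] [Module A M]
  [Module (upperTriangularTwo A) M] [IsScalarTower A (upperTriangularTwo A) M]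

local notation "Λ" => upperTriangularTwo A
local notation "𝐜" => upperTriangularCoordinates A

variable (A M)

/-- The `A`-linear forms on `M` vanishing on `e₂₂ M`, that is, the dual of `e₁₁ M`. -/
def upperDual : Submodule Aᵐᵒᵖ (LeftDual A M) :=
  LinearMap.ker (LinearMap.lcomp Aᵐᵒᵖ A 𝐜.smulE₂₂)

/-- The `A`-linear forms on `M` vanishing on `e₁₁ M`, that is, the dual of `e₂₂ M`. -/
def lowerDual : Submodule Aᵐᵒᵖ (LeftDual A M) :=
  LinearMap.ker (LinearMap.lcomp Aᵐᵒᵖ A 𝐜.smulE₁₁)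

/-- The `A`-linear forms on `M` vanishing on `e₂₂ M` and on `e₁₂ M`, that is, the dual of the
cokernel of `e₁₂ : e₂₂ M → e₁₁ M`. -/
def cokernelDual : Submodule Aᵐᵒᵖ (LeftDual A M) :=
  upperDual A M ⊓ LinearMap.ker (LinearMap.lcomp Aᵐᵒᵖ A 𝐜.smulE₁₂)

variable {A M}

theorem mem_upperDual_iff {v : LeftDual A M} :
    v ∈ upperDual A M ↔ ∀ m, v (𝐜.e₂₂ • m) = 0 := LinearMap.ext_iff

theorem mem_lowerDual_iff {v : LeftDual A M} :
    v ∈ lowerDual A M ↔ ∀ m, v (𝐜.e₁₁ • m) = 0 := LinearMap.ext_iff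

theorem mem_cokernelDual_iff {v : LeftDual A M} :
    v ∈ cokernelDual A M ↔ v ∈ upperDual A M ∧ ∀ m, v (𝐜.e₁₂ • m) = 0 :=
  and_congr_right fun _ => LinearMap.ext_iff

theorem apply_e₁₁_smul {v : LeftDual A M} (hv : v ∈ upperDual A M) (m : M) :
    v (𝐜.e₁₁ • m) = v m := by
  conv_rhs => rw [← 𝐜.e₁₁_smul_add_e₂₂_smul m, map_add, mem_upperDual_iff.1 hv, add_zero]

theorem apply_e₂₂_smul {v : LeftDual A M} (hv : v ∈ lowerDual A M) (m : M) :
    v (𝐜.e₂₂ • m) = v m := by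
  conv_rhs => rw [← 𝐜.e₁₁_smul_add_e₂₂_smul m, map_add, mem_lowerDual_iff.1 hv, zero_add]

theorem comp_smulE₁₁_mem_upperDual (v : LeftDual A M) : v ∘ₗ 𝐜.smulE₁₁ ∈ upperDual A M :=
  mem_upperDual_iff.2 fun m => (congrArg v (𝐜.e₁₁_smul_smul 𝐜.e₂₂ m)).trans (by simp)

theorem comp_smulE₂₂_mem_lowerDual (v : LeftDual A M) : v ∘ₗ 𝐜.smulE₂₂ ∈ lowerDual A M :=
  mem_lowerDual_iff.2 fun m => (congrArg v (𝐜.e₂₂_smul_smul 𝐜.e₁₁ m)).trans (by simp)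

theorem comp_smulE₁₂_mem_lowerDual (v : LeftDual A M) : v ∘ₗ 𝐜.smulE₁₂ ∈ lowerDual A M :=
  mem_lowerDual_iff.2 fun m => (congrArg v (𝐜.e₁₂_smul_smul 𝐜.e₁₁ m)).trans (by simp)

theorem isCompl_upperDual_lowerDual : IsCompl (upperDual A M) (lowerDual A M) := by
  refine ⟨Submodule.disjoint_def.2 fun v hu hl => LinearMap.ext fun m => ?_,
    Submodule.codisjoint_iff_exists_add_eq.2 fun v => ?_⟩
  · rw [← apply_e₁₁_smul hu, mem_lowerDual_iff.1 hl, LinearMap.zero_apply]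
  · refine ⟨_, _, comp_smulE₁₁_mem_upperDual v, comp_smulE₂₂_mem_lowerDual v, ?_⟩
    exact LinearMap.ext fun m =>
      (map_add v _ _).symm.trans (congrArg v (𝐜.e₁₁_smul_add_e₂₂_smul m))

variable (A M) in
/-- The dual of `e₁₂ : e₂₂ M → e₁₁ M`. -/
def dualE₁₂ : upperDual A M →ₗ[Aᵐᵒᵖ] lowerDual A M :=
  (LinearMap.lcomp Aᵐᵒᵖ A 𝐜.smulE₁₂ ∘ₗ (upperDual A M).subtype).codRestrict (lowerDual A M)
    fun v => comp_smulE₁₂_mem_lowerDual v.1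

variable (A M) in
/-- The inclusion of the dual of the cokernel of `e₁₂ : e₂₂ M → e₁₁ M` in the dual of `e₁₁ M`. -/
def cokernelDualInclusion : cokernelDual A M →ₗ[Aᵐᵒᵖ] upperDual A M :=
  Submodule.inclusion inf_le_left

@[simp] theorem coe_cokernelDualInclusion (u : cokernelDual A M) :
    (cokernelDualInclusion A M u : LeftDual A M) = u := rfl

theorem exact_cokernelDualInclusion_dualE₁₂ :
    Function.Exact (cokernelDualInclusion A M) (dualE₁₂ A M) := fun v =>
  ⟨fun h => ⟨⟨v.1, v.2, congrArg Subtype.val h⟩, rfl⟩, fun ⟨u, hu⟩ => hu ▸ Subtype.ext u.2.2⟩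

theorem dualE₁₂_surjective (h : 𝐜.DualSurjective M) : Function.Surjective (dualE₁₂ A M) := by
  intro w
  obtain ⟨v, hv⟩ := h w.1
  refine ⟨⟨v ∘ₗ 𝐜.smulE₁₁, comp_smulE₁₁_mem_upperDual v⟩, Subtype.ext (LinearMap.ext fun m => ?_)⟩
  calc
    v (𝐜.e₁₁ • 𝐜.e₁₂ • m) = v (𝐜.e₁₂ • m) := by rw [𝐜.e₁₁_smul_smul]; simp
    _ = w.1 m := by rw [hv, apply_e₂₂_smul w.2]

/-- The forms `m ↦ φ(m)ᵢⱼ` for `φ` in the dual of `M` over `T₂(A)`. -/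
def entryForm (i j : Fin 2) : LeftDual Λ M →ₗ[Aᵐᵒᵖ] LeftDual A M where
  toFun φ :=
    { toFun := fun m => (φ m).1 i j
      map_add' := fun m m' => by simp
      map_smul' := fun a m => by simp [LinearMap.map_smul_of_tower φ a m] }
  map_add' φ ψ := rfl
  map_smul' a φ := LinearMap.ext fun m => upperTriangular_op_smul_apply a.unop (φ m) i j

theorem coord_apply (φ : LeftDual Λ M) (m : M) :
    𝐜.coord (φ m) = (entryForm 0 0 φ m, entryForm 0 1 φ m, entryForm 1 1 φ m) := rfl

theorem entryForm_zero_zero_mem_cokernelDual (φ : LeftDual Λ M) :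
    entryForm 0 0 φ ∈ cokernelDual A M := by
  refine mem_cokernelDual_iff.2 ⟨mem_upperDual_iff.2 fun m => ?_, fun m => ?_⟩
  · exact show (𝐜.coord (φ (𝐜.e₂₂ • m))).1 = 0 by simp [𝐜.coord_mul]
  · exact show (𝐜.coord (φ (𝐜.e₁₂ • m))).1 = 0 by simp [𝐜.coord_mul]

theorem entryForm_zero_one_mem_upperDual (φ : LeftDual Λ M) :
    entryForm 0 1 φ ∈ upperDual A M :=
  mem_upperDual_iff.2 fun m =>
    show (𝐜.coord (φ (𝐜.e₂₂ • m))).2.1 = 0 by simp [𝐜.coord_mul]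

theorem entryForm_zero_one_e₁₂_smul (φ : LeftDual Λ M) (m : M) :
    entryForm 0 1 φ (𝐜.e₁₂ • m) = entryForm 1 1 φ m :=
  show (𝐜.coord (φ (𝐜.e₁₂ • m))).2.1 = (𝐜.coord (φ m)).2.2 by simp [𝐜.coord_mul]

/-- The `T₂(A)`-linear form with diagonal entry `u` and off-diagonal entry `v` in the first row. -/
def formOfRow (t : cokernelDual A M × upperDual A M) : LeftDual Λ M where
  toFun m := 𝐜.coord.symm (t.1.1 m, t.2.1 m, t.2.1 (𝐜.e₁₂ • m))
  map_add' m m' := 𝐜.coord.injective (by simp)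
  map_smul' x m := 𝐜.coord.injective (by
    have hu : t.1.1 (x • m) = (𝐜.coord x).1 * t.1.1 m := by
      rw [← apply_e₁₁_smul t.1.2.1, 𝐜.e₁₁_smul_smul]
      simp [apply_e₁₁_smul t.1.2.1, (mem_cokernelDual_iff.1 t.1.2).2]
    have hv : t.2.1 (x • m) = (𝐜.coord x).1 * t.2.1 m + (𝐜.coord x).2.1 * t.2.1 (𝐜.e₁₂ • m) := by
      rw [← apply_e₁₁_smul t.2.2, 𝐜.e₁₁_smul_smul]
      simp [apply_e₁₁_smul t.2.2]
    simp [𝐜.coord_mul, hu, hv, 𝐜.e₁₂_smul_smul])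

variable (A M) in
/-- A `T₂(A)`-linear form on `M` is determined by its first row. -/
def firstRow : LeftDual Λ M ≃ₗ[Aᵐᵒᵖ] cokernelDual A M × upperDual A M where
  toFun φ := (⟨entryForm 0 0 φ, entryForm_zero_zero_mem_cokernelDual φ⟩,
    ⟨entryForm 0 1 φ, entryForm_zero_one_mem_upperDual φ⟩)
  map_add' φ ψ := rfl
  map_smul' a φ := Prod.ext (Subtype.ext (map_smul (entryForm 0 0) a φ))
    (Subtype.ext (map_smul (entryForm 0 1) a φ))
  invFun := formOfRow
  left_inv φ := LinearMap.ext fun m => 𝐜.coord.injective (by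
    simp [formOfRow, coord_apply, entryForm_zero_one_e₁₂_smul])
  right_inv t := rfl

theorem coord_apply_eq_firstRow (φ : LeftDual Λ M) (m : M) :
    𝐜.coord (φ m) = ((firstRow A M φ).1.1 m, (firstRow A M φ).2.1 m,
      (dualE₁₂ A M (firstRow A M φ).2).1 m) := by
  rw [coord_apply, ← entryForm_zero_one_e₁₂_smul]
  rfl

end Dual

section DoubleSemiGorensteinProjective

open MulOpposite

variable {A : Type u} [Ring A] {M : Type u} [AddCommGroup M] [Module A M]
  [Module (upperTriangularTwo A) M] [IsScalarTower A (upperTriangularTwo A) M]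

local notation "Λ" => upperTriangularTwo A
local notation "𝐜" => upperTriangularCoordinates A
local notation "𝐜ᵒᵖ" => upperTriangularOpCoordinates A

theorem firstRow_op_smul (x : Λ) (φ : LeftDual Λ M) :
    firstRow A M (op x • φ) = (op (𝐜.coord x).1 • (firstRow A M φ).1,
      op (𝐜.coord x).2.1 • cokernelDualInclusion A M (firstRow A M φ).1 +
        op (𝐜.coord x).2.2 • (firstRow A M φ).2) :=
  Prod.ext
    (Subtype.ext (LinearMap.ext fun m => congrArg (·.1) (𝐜.coord_mul (φ m) x)))
    (Subtype.ext (LinearMap.ext fun m => congrArg (·.2.1) (𝐜.coord_mul (φ m) x)))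

theorem firstRow_e₁₁_smul (φ : LeftDual Λ M) :
    firstRow A M (op 𝐜.e₁₁ • φ) = ((firstRow A M φ).1, 0) := by
  simp only [firstRow_op_smul, 𝐜.coord_e₁₁, op_one, op_zero, one_smul, zero_smul, add_zero]

theorem firstRow_e₁₂_smul (φ : LeftDual Λ M) :
    firstRow A M (op 𝐜.e₁₂ • φ) = (0, cokernelDualInclusion A M (firstRow A M φ).1) := by
  simp only [firstRow_op_smul, 𝐜.coord_e₁₂, op_one, op_zero, one_smul, zero_smul, add_zero]

theorem firstRow_e₂₂_smul (φ : LeftDual Λ M) :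
    firstRow A M (op 𝐜.e₂₂ • φ) = (0, (firstRow A M φ).2) := by
  simp only [firstRow_op_smul, 𝐜.coord_e₂₂, op_one, op_zero, one_smul, zero_smul, zero_add]

theorem dualSurjective_leftDual_iff :
    𝐜ᵒᵖ.DualSurjective (LeftDual Λ M) ↔
      ∀ u : cokernelDual A M →ₗ[Aᵐᵒᵖ] Aᵐᵒᵖ, ∃ w : upperDual A M →ₗ[Aᵐᵒᵖ] Aᵐᵒᵖ,
        w ∘ₗ cokernelDualInclusion A M = u := by
  refine ⟨fun H u => ?_, fun H h => ?_⟩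
  · obtain ⟨v, hv⟩ := H (u ∘ₗ LinearMap.fst _ _ _ ∘ₗ (firstRow A M).toLinearMap)
    refine ⟨v ∘ₗ (firstRow A M).symm.toLinearMap ∘ₗ LinearMap.inr _ _ _,
      LinearMap.ext fun t => ?_⟩
    have e₁₂_eq : op 𝐜.e₁₂ • (firstRow A M).symm (t, 0) =
        (firstRow A M).symm (0, cokernelDualInclusion A M t) := (firstRow A M).injective
      (by rw [firstRow_e₁₂_smul, LinearEquiv.apply_symm_apply, LinearEquiv.apply_symm_apply])
    calc
      v ((firstRow A M).symm (0, cokernelDualInclusion A M t)) =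
          v (op 𝐜.e₁₂ • (firstRow A M).symm (t, 0)) := by rw [e₁₂_eq]
      _ = u (firstRow A M (op 𝐜.e₁₁ • (firstRow A M).symm (t, 0))).1 := hv _
      _ = u t := by rw [firstRow_e₁₁_smul, LinearEquiv.apply_symm_apply]
  · obtain ⟨w, hw⟩ := H (h ∘ₗ (firstRow A M).symm.toLinearMap ∘ₗ LinearMap.inl _ _ _)
    refine ⟨w ∘ₗ LinearMap.snd _ _ _ ∘ₗ (firstRow A M).toLinearMap, fun φ => ?_⟩
    have e₁₁_eq : op 𝐜.e₁₁ • φ = (firstRow A M).symm ((firstRow A M φ).1, 0) :=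
      (firstRow A M).injective (by rw [firstRow_e₁₁_smul, LinearEquiv.apply_symm_apply])
    calc
      w (firstRow A M (op 𝐜.e₁₂ • φ)).2 = w (cokernelDualInclusion A M (firstRow A M φ).1) := by
        rw [firstRow_e₁₂_smul]
      _ = h ((firstRow A M).symm ((firstRow A M φ).1, 0)) := LinearMap.congr_fun hw _
      _ = h (op 𝐜.e₁₁ • φ) := by rw [e₁₁_eq]

theorem positiveExtVanishes_leftDual_iff :
    PositiveExtVanishes Aᵐᵒᵖ (LeftDual A M) Aᵐᵒᵖ ↔
      PositiveExtVanishes Aᵐᵒᵖ (upperDual A M) Aᵐᵒᵖ ∧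
        PositiveExtVanishes Aᵐᵒᵖ (lowerDual A M) Aᵐᵒᵖ :=
  (positiveExtVanishes_congr (Submodule.prodEquivOfIsCompl _ _ isCompl_upperDual_lowerDual).symm
    (.refl _ _)).trans positiveExtVanishes_prod_left_iff

theorem positiveExtVanishes_upperTriangular_leftDual_iff :
    PositiveExtVanishes Aᵐᵒᵖ (LeftDual Λ M) Aᵐᵒᵖ ↔
      PositiveExtVanishes Aᵐᵒᵖ (cokernelDual A M) Aᵐᵒᵖ ∧
        PositiveExtVanishes Aᵐᵒᵖ (upperDual A M) Aᵐᵒᵖ :=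
  (positiveExtVanishes_congr (firstRow A M) (.refl _ _)).trans positiveExtVanishes_prod_left_iff

theorem isRightSemiGorensteinProjective_leftDual_iff (h : 𝐜.DualSurjective M) :
    IsRightSemiGorensteinProjective Λ (LeftDual Λ M) ↔
      IsRightSemiGorensteinProjective A (LeftDual A M) := by
  have key (hX : PositiveExtVanishes Aᵐᵒᵖ (upperDual A M) Aᵐᵒᵖ) :
      PositiveExtVanishes Aᵐᵒᵖ (lowerDual A M) Aᵐᵒᵖ ↔ 𝐜ᵒᵖ.DualSurjective (LeftDual Λ M) ∧
        PositiveExtVanishes Aᵐᵒᵖ (cokernelDual A M) Aᵐᵒᵖ := by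
    rw [dualSurjective_leftDual_iff]
    exact positiveExtVanishes_left_iff_of_exact (X := cokernelDual A M) (Y := upperDual A M)
      (Submodule.inclusion_injective _) exact_cokernelDualInclusion_dualE₁₂
      (dualE₁₂_surjective h) hX
  rw [← positiveExtVanishes_op_iff, ← positiveExtVanishes_op_iff, positiveExtVanishes_self_iff,
    𝐜ᵒᵖ.isSemiGorensteinProjective_iff, ← positiveExtVanishes_self_iff,
    positiveExtVanishes_leftDual_iff, positiveExtVanishes_upperTriangular_leftDual_iff]
  tauto

theorem isDoubleSemiGorensteinProjective_iff :
    IsDoubleSemiGorensteinProjective Λ M ↔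
      IsDoubleSemiGorensteinProjective A M ∧ 𝐜.DualSurjective M := by
  have key := isRightSemiGorensteinProjective_leftDual_iff (A := A) (M := M)
  rw [IsDoubleSemiGorensteinProjective, IsDoubleSemiGorensteinProjective,
    𝐜.isSemiGorensteinProjective_iff]
  tauto

end DoubleSemiGorensteinProjective

section CanonicalMap

open MulOpposite

variable {A : Type u} [Ring A]

local notation "Λ" => upperTriangularTwo A
local notation "𝐜" => upperTriangularCoordinates A

theorem exists_comp_eq_of_ker_le {S X Y Z : Type u} [Ring S] [AddCommGroup X] [Module S X]
    [AddCommGroup Y] [Module S Y] [AddCommGroup Z] [Module S Z] {g : X →ₗ[S] Y} {f : X →ₗ[S] Z}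
    (hg : Function.Surjective g) (h : LinearMap.ker g ≤ LinearMap.ker f) :
    ∃ k : Y →ₗ[S] Z, k ∘ₗ g = f :=
  ⟨(LinearMap.ker g).liftQ f h ∘ₗ (g.quotKerEquivOfSurjective hg).symm.toLinearMap,
    LinearMap.ext fun x => by
      rw [LinearMap.comp_apply, LinearMap.comp_apply, LinearEquiv.coe_coe,
        LinearMap.quotKerEquivOfSurjective_symm_apply, Submodule.liftQ_apply]⟩

/-- An entry of upper triangular matrices, as a map of right `A`-modules. -/
def upperTriangularRightEntry (i j : Fin 2) : upperTriangularTwo A →ₗ[Aᵐᵒᵖ] A where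
  toFun x := x.1 i j
  map_add' _ _ := rfl
  map_smul' a x := upperTriangular_op_smul_apply a.unop x i j

section Coordinates

variable {N : Type u} [AddCommGroup N] [Module (upperTriangularTwo A)ᵐᵒᵖ N]

theorem coord_apply_e₁₂_smul (F : RightDual Λ N) (φ : N) :
    𝐜.coord (F (op 𝐜.e₁₂ • φ)) = (0, (𝐜.coord (F φ)).1, 0) := by
  rw [map_smul, op_smul_eq_mul, 𝐜.coord_mul, 𝐜.coord_e₁₂]
  simp

theorem coord_apply_e₂₂_smul (F : RightDual Λ N) (φ : N) :
    𝐜.coord (F (op 𝐜.e₂₂ • φ)) = (0, (𝐜.coord (F φ)).2) := by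
  rw [map_smul, op_smul_eq_mul, 𝐜.coord_mul, 𝐜.coord_e₂₂]
  simp

end Coordinates

variable {M : Type u} [AddCommGroup M] [Module A M]
  [Module (upperTriangularTwo A) M] [IsScalarTower A (upperTriangularTwo A) M]

theorem dualE₁₂_cokernelDualInclusion (u : cokernelDual A M) :
    dualE₁₂ A M (cokernelDualInclusion A M u) = 0 :=
  exact_cokernelDualInclusion_dualE₁₂.apply_apply_eq_zero u

variable (A M) in
/-- The map `M^{**} → M^{**}` from the bidual over `A` to the bidual over `T₂(A)`, under which the
canonical maps of `M` correspond. -/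
def bidualMap : RightDual A (LeftDual A M) →+ RightDual Λ (LeftDual Λ M) where
  toFun G :=
    { toFun := fun φ => 𝐜.coord.symm (G (firstRow A M φ).1, G (firstRow A M φ).2,
        G (dualE₁₂ A M (firstRow A M φ).2))
      map_add' := fun φ ψ => 𝐜.coord.injective (by simp)
      map_smul' := fun x φ => 𝐜.coord.injective (by
        rw [← op_unop x, firstRow_op_smul, map_add, map_smul, map_smul,
          dualE₁₂_cokernelDualInclusion, RingHom.id_apply, op_smul_eq_mul, 𝐜.coord_mul]
        simp) }
  map_zero' := LinearMap.ext fun φ => 𝐜.coord.injective (by simp)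
  map_add' F G := LinearMap.ext fun φ => 𝐜.coord.injective (by simp)

theorem coord_bidualMap (G : RightDual A (LeftDual A M)) (φ : LeftDual Λ M) :
    𝐜.coord (bidualMap A M G φ) = (G (firstRow A M φ).1, G (firstRow A M φ).2,
      G (dualE₁₂ A M (firstRow A M φ).2)) :=
  𝐜.coord.apply_symm_apply _

theorem bidualMap_canonicalMap (m : M) :
    bidualMap A M (canonicalMap A M m) = canonicalMap Λ M m :=
  LinearMap.ext fun φ => 𝐜.coord.injective
    ((coord_bidualMap _ φ).trans (coord_apply_eq_firstRow φ m).symm)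

theorem bidualMap_injective (h : 𝐜.DualSurjective M) : Function.Injective (bidualMap A M) := by
  refine (injective_iff_map_eq_zero _).2 fun G hG => ?_
  have hrow (v : upperDual A M) : (G v, G (dualE₁₂ A M v)) = 0 := by
    have := congrArg (·.2) (coord_bidualMap G ((firstRow A M).symm (0, v)))
    simpa [hG] using this.symm
  refine LinearMap.ext fun w => ?_
  obtain ⟨u, l, hu, hl, rfl⟩ := Submodule.codisjoint_iff_exists_add_eq.1
    isCompl_upperDual_lowerDual.codisjoint w
  obtain ⟨v, hv⟩ := dualE₁₂_surjective h ⟨l, hl⟩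
  have hGu : G u = 0 := congrArg (·.1) (hrow ⟨u, hu⟩)
  have hGl : G l = 0 := by simpa [hv] using congrArg (·.2) (hrow v)
  rw [map_add, hGu, hGl, add_zero, LinearMap.zero_apply]

/-- The entries of the second column of a form `F` on the dual over `T₂(A)`, evaluated at the
elements whose first row is `(0, v)`. -/
def bidualColumn (F : RightDual Λ (LeftDual Λ M)) (i : Fin 2) : upperDual A M →ₗ[Aᵐᵒᵖ] A :=
  upperTriangularRightEntry i 1 ∘ₗ F.restrictScalars Aᵐᵒᵖ ∘ₗ (firstRow A M).symm.toLinearMap ∘ₗ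
    LinearMap.inr _ _ _

theorem coord_apply_firstRow_symm (F : RightDual Λ (LeftDual Λ M)) (v : upperDual A M) :
    (𝐜.coord (F ((firstRow A M).symm (0, v)))).2 = (bidualColumn F 0 v, bidualColumn F 1 v) := rfl

theorem bidualColumn_cokernelDualInclusion (F : RightDual Λ (LeftDual Λ M)) (φ : LeftDual Λ M) :
    (bidualColumn F 0 (cokernelDualInclusion A M (firstRow A M φ).1),
      bidualColumn F 1 (cokernelDualInclusion A M (firstRow A M φ).1)) =
        ((𝐜.coord (F φ)).1, 0) := by
  rw [← coord_apply_firstRow_symm, ← firstRow_e₁₂_smul, LinearEquiv.symm_apply_apply,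
    coord_apply_e₁₂_smul]

theorem bidualColumn_firstRow_snd (F : RightDual Λ (LeftDual Λ M)) (φ : LeftDual Λ M) :
    (bidualColumn F 0 (firstRow A M φ).2, bidualColumn F 1 (firstRow A M φ).2) =
      (𝐜.coord (F φ)).2 := by
  rw [← coord_apply_firstRow_symm, ← firstRow_e₂₂_smul, LinearEquiv.symm_apply_apply,
    coord_apply_e₂₂_smul]

theorem bidualMap_surjective (h : 𝐜.DualSurjective M) : Function.Surjective (bidualMap A M) := by
  intro F
  obtain ⟨g, hg⟩ : ∃ g : lowerDual A M →ₗ[Aᵐᵒᵖ] A, g ∘ₗ dualE₁₂ A M = bidualColumn F 1 := by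
    refine exists_comp_eq_of_ker_le (X := upperDual A M) (Y := lowerDual A M) (dualE₁₂_surjective h)
      fun v hv => ?_
    obtain ⟨u, rfl⟩ := (exact_cokernelDualInclusion_dualE₁₂ v).1 hv
    have := congrArg (·.2) (bidualColumn_cokernelDualInclusion F ((firstRow A M).symm (u, 0)))
    rwa [LinearEquiv.apply_symm_apply] at this
  let G := LinearMap.ofIsCompl isCompl_upperDual_lowerDual (bidualColumn F 0) g
  have hG₁ (v : upperDual A M) : G v = bidualColumn F 0 v := LinearMap.ofIsCompl_apply_left _ v
  have hG₂ (v : upperDual A M) : G (dualE₁₂ A M v) = bidualColumn F 1 v :=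
    (LinearMap.ofIsCompl_apply_right _ _).trans (LinearMap.congr_fun hg v)
  refine ⟨G, LinearMap.ext fun φ => 𝐜.coord.injective ?_⟩
  have fst_eq : bidualColumn F 0 (cokernelDualInclusion A M (firstRow A M φ).1) =
      (𝐜.coord (F φ)).1 := congrArg (·.1) (bidualColumn_cokernelDualInclusion F φ)
  calc
    𝐜.coord (bidualMap A M G φ) =
        (bidualColumn F 0 (cokernelDualInclusion A M (firstRow A M φ).1),
          bidualColumn F 0 (firstRow A M φ).2, bidualColumn F 1 (firstRow A M φ).2) := by
      rw [coord_bidualMap, ← hG₁, ← hG₁, ← hG₂]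
      rfl
    _ = 𝐜.coord (F φ) := by
      rw [bidualColumn_firstRow_snd, fst_eq]

theorem canonicalMap_injective_iff (h : 𝐜.DualSurjective M) :
    Function.Injective (canonicalMap Λ M) ↔ Function.Injective (canonicalMap A M) := by
  rw [← (bidualMap_injective h).of_comp_iff,
    show bidualMap A M ∘ canonicalMap A M = canonicalMap Λ M from funext bidualMap_canonicalMap]

theorem canonicalMap_surjective_iff (h : 𝐜.DualSurjective M) :
    Function.Surjective (canonicalMap Λ M) ↔ Function.Surjective (canonicalMap A M) := by
  rw [← Function.Surjective.of_comp_iff' ⟨bidualMap_injective h, bidualMap_surjective h⟩,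
    show bidualMap A M ∘ canonicalMap A M = canonicalMap Λ M from funext bidualMap_canonicalMap]

theorem isReflexiveModule_iff (h : 𝐜.DualSurjective M) :
    IsReflexiveModule Λ M ↔ IsReflexiveModule A M :=
  and_congr (canonicalMap_injective_iff h) (canonicalMap_surjective_iff h)

end CanonicalMap

section Torsionless

theorem IsTorsionless.exists_injective_pi {S N : Type u} [Ring S] [AddCommGroup N] [Module S N]
    (h : IsTorsionless S N) : ∃ (k : ℕ) (f : N →ₗ[S] (Fin k → S)), Function.Injective f := by
  obtain ⟨P, _, _, _, _, f, hf⟩ := h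
  obtain ⟨k, π, s, -, hs, -⟩ := Module.Finite.exists_comp_eq_id_of_projective S P
  exact ⟨k, s ∘ₗ f, hs.comp hf⟩

theorem isTorsionless_of_injective_pi {S N Q : Type u} {k : ℕ} [Ring S] [AddCommGroup N]
    [Module S N] [AddCommGroup Q] [Module S Q] [Module.Finite S Q] [Module.Projective S Q]
    (f : N →ₗ[S] (Fin k → Q)) (hf : Function.Injective f) : IsTorsionless S N :=
  ⟨Fin k → Q, inferInstance, inferInstance, inferInstance,
    .of_equiv (DFinsupp.linearEquivFunOnFintype (R := S) (M := fun _ : Fin k => Q)), f, hf⟩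

theorem IsTorsionless.restrictScalars {B Γ M : Type u} [Ring B] [Ring Γ] [Module B Γ]
    [IsScalarTower B Γ Γ] [Module.Finite B Γ] [Module.Projective B Γ] [AddCommGroup M]
    [Module B M] [Module Γ M] [IsScalarTower B Γ M] (h : IsTorsionless Γ M) :
    IsTorsionless B M := by
  obtain ⟨k, f, hf⟩ := h.exists_injective_pi
  exact isTorsionless_of_injective_pi (f.restrictScalars B) hf

end Torsionless

theorem exists_module_isScalarTower (B Γ M : Type u) [Ring B] [Ring Γ] [Module B Γ]
    [IsScalarTower B Γ Γ] [AddCommGroup M] [Module Γ M] :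
    ∃ _ : Module B M, IsScalarTower B Γ M :=
  let i : Module B M := Module.compHom M (RingHom.smulOneHom : B →+* Γ)
  ⟨i, ⟨fun b x m => show (b • x) • m = (b • (1 : Γ)) • x • m by
    rw [smul_smul, smul_one_mul]⟩⟩

namespace TriangularCoordinates

variable {B Γ : Type u} [Ring B] [Ring Γ] [Module B Γ] (c : TriangularCoordinates B Γ)

theorem exists_module_smul_eq (L : Type u) [AddCommGroup L] [Module B L] :
    ∃ (_ : Module Γ L) (_ : IsScalarTower B Γ L), ∀ (x : Γ) (l : L), x • l = c.fstHom x • l := by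
  let i : Module Γ L := Module.compHom L c.fstHom
  have hi (x : Γ) (l : L) : x • l = c.fstHom x • l := rfl
  exact ⟨i, ⟨fun b x l => by simp [hi, fstHom, mul_smul]⟩, hi⟩

variable {M : Type u} [AddCommGroup M] [Module B M] [Module Γ M]

theorem dualSurjective_of_smul_eq (h : ∀ (x : Γ) (m : M), x • m = c.fstHom x • m) :
    c.DualSurjective M :=
  fun w => ⟨0, fun m => by simp [h, fstHom]⟩

theorem isTorsionless_of_smul_eq (h : ∀ (x : Γ) (m : M), x • m = c.fstHom x • m)
    (hM : IsTorsionless B M) : IsTorsionless Γ M := by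
  obtain ⟨k, f, hf⟩ := hM.exists_injective_pi
  let j : M →ₗ[Γ] (Fin k → Γ) :=
    { toFun := fun m i => c.coord.symm (f m i, 0, 0)
      map_add' := fun m m' => funext fun i => c.coord.injective (by simp)
      map_smul' := fun x m => funext fun i => c.coord.injective (by simp [h, coord_mul, fstHom]) }
  refine isTorsionless_of_injective_pi j fun m m' hm => hf (funext fun i => ?_)
  exact congrArg Prod.fst (c.coord.symm.injective (congrFun hm i))

end TriangularCoordinates

instance (A : Type u) [Ring A] : Module.Finite A (upperTriangularTwo A) :=
  .equiv (upperTriangularEntries A).symm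

instance (A : Type u) [Ring A] : Module.Projective A (upperTriangularTwo A) :=
  (upperTriangularCoordinates A).projective

theorem theorem1p6_general (A : Type u) [Ring A] :
    ((∀ (L : Type u) [AddCommGroup L] [Module A L] [Module.Finite A L],
        IsTorsionless A L → IsDoubleSemiGorensteinProjective A L →
          IsGorensteinProjective A L) ↔
      (∀ (M : Type u) [AddCommGroup M] [Module (upperTriangularTwo A) M]
        [Module.Finite (upperTriangularTwo A) M],
        IsTorsionless (upperTriangularTwo A) M →
          IsDoubleSemiGorensteinProjective (upperTriangularTwo A) M →
            IsGorensteinProjective (upperTriangularTwo A) M)) ∧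
    ((∀ (L : Type u) [AddCommGroup L] [Module A L] [Module.Finite A L],
        IsDoubleSemiGorensteinProjective A L → Function.Surjective (canonicalMap A L) →
          IsGorensteinProjective A L) ↔
      (∀ (M : Type u) [AddCommGroup M] [Module (upperTriangularTwo A) M]
        [Module.Finite (upperTriangularTwo A) M],
        IsDoubleSemiGorensteinProjective (upperTriangularTwo A) M →
          Function.Surjective (canonicalMap (upperTriangularTwo A) M) →
            IsGorensteinProjective (upperTriangularTwo A) M)) := by
  let c := upperTriangularCoordinates A
  refine ⟨⟨fun H M _ _ _ ht hd => ?_, fun H L _ _ _ ht hd => ?_⟩,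
    ⟨fun H M _ _ _ hd hs => ?_, fun H L _ _ _ hd hs => ?_⟩⟩
  · obtain ⟨_, _⟩ := exists_module_isScalarTower A (upperTriangularTwo A) M
    have := Module.Finite.trans (R := A) (upperTriangularTwo A) M
    obtain ⟨hA, hD⟩ := isDoubleSemiGorensteinProjective_iff.1 hd
    exact ⟨hd, (isReflexiveModule_iff hD).2 (H M ht.restrictScalars hA).2⟩
  · obtain ⟨_, _, h⟩ := c.exists_module_smul_eq L
    have := Module.Finite.of_restrictScalars_finite A (upperTriangularTwo A) L
    have hD := c.dualSurjective_of_smul_eq h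
    exact ⟨hd, (isReflexiveModule_iff hD).1 (H L (c.isTorsionless_of_smul_eq h ht)
      (isDoubleSemiGorensteinProjective_iff.2 ⟨hd, hD⟩)).2⟩
  · obtain ⟨_, _⟩ := exists_module_isScalarTower A (upperTriangularTwo A) M
    have := Module.Finite.trans (R := A) (upperTriangularTwo A) M
    obtain ⟨hA, hD⟩ := isDoubleSemiGorensteinProjective_iff.1 hd
    exact ⟨hd, (isReflexiveModule_iff hD).2 (H M hA ((canonicalMap_surjective_iff hD).1 hs)).2⟩
  · obtain ⟨_, _, h⟩ := c.exists_module_smul_eq L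
    have := Module.Finite.of_restrictScalars_finite A (upperTriangularTwo A) L
    have hD := c.dualSurjective_of_smul_eq h
    exact ⟨hd, (isReflexiveModule_iff hD).1 (H L
      (isDoubleSemiGorensteinProjective_iff.2 ⟨hd, hD⟩)
      ((canonicalMap_surjective_iff hD).2 hs)).2⟩

theorem theorem1p6 (R : Type v) [CommRing R] [IsArtinianRing R]
    (A : Type u) [Ring A] [Algebra R A] [Module.Finite R A] :
    ((∀ (L : Type u) [AddCommGroup L] [Module A L] [Module.Finite A L],
        IsTorsionless A L → IsDoubleSemiGorensteinProjective A L →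
          IsGorensteinProjective A L) ↔
      (∀ (M : Type u) [AddCommGroup M] [Module (upperTriangularTwo A) M]
        [Module.Finite (upperTriangularTwo A) M],
        IsTorsionless (upperTriangularTwo A) M →
          IsDoubleSemiGorensteinProjective (upperTriangularTwo A) M →
            IsGorensteinProjective (upperTriangularTwo A) M)) ∧
    ((∀ (L : Type u) [AddCommGroup L] [Module A L] [Module.Finite A L],
        IsDoubleSemiGorensteinProjective A L → Function.Surjective (canonicalMap A L) →
          IsGorensteinProjective A L) ↔
      (∀ (M : Type u) [AddCommGroup M] [Module (upperTriangularTwo A) M]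
        [Module.Finite (upperTriangularTwo A) M],
        IsDoubleSemiGorensteinProjective (upperTriangularTwo A) M →
          Function.Surjective (canonicalMap (upperTriangularTwo A) M) →
            IsGorensteinProjective (upperTriangularTwo A) M)) :=
  theorem1p6_general A
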